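/- Let $k$ be a field. A $k$-algebra $A$ is called Frobenius if it is finite dimensional and $A\simeq A^*=\mathrm{Hom}_k(A,k)$ as left $A$-modules, where $(a\cdot f)(x)=f(xa)$ for $a,x\in A$, $f\in A^*$. Let $H$ be a finite dimensional Hopf algebra over $k$, with comultiplication $h\mapsto\sum h_1\otimes h_2$ and counit $\varepsilon$, and let $A$ be a finite dimensional left $H$-module algebra, that is, a finite dimensional $k$-algebra which is a left $H$-module such that $h\cdot 1=\varepsilon(h)1$ and $h\cdot(ab)=\sum(h_1\cdot a)(h_2\cdot b)$ for all $h\in H$, $a,b\in A$. Let $A\# H$ be the smash product, i.e. the $k$-space $A\otimes_k H$ (write $a\# h$ for $a\otimes h$) with unit $1\# 1$ and multiplication $$(a\# h)(b\# g)=\sum a(h_1\cdot b)\# h_2g .$$ **Theorem.** $A\# H$ is Frobenius if and only if $A$ is Frobenius. -/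

import Mathlib

open scoped TensorProduct

/-- The dual space `A* = Hom_k(A, k)` of a `k`-algebra `A`, regarded as a left `A`-module
through `(a • f)(x) = f (x a)`. -/
def LeftDual (k A : Type*) [CommRing k] [Ring A] [Algebra k A] : Type _ := A →ₗ[k] k

namespace LeftDual

variable {k A : Type*} [CommRing k] [Ring A] [Algebra k A]

instance : AddCommGroup (LeftDual k A) := inferInstanceAs (AddCommGroup (A →ₗ[k] k))

instance : FunLike (LeftDual k A) A k := inferInstanceAs (FunLike (A →ₗ[k] k) A k)

instance : SMul A (LeftDual k A) where
  smul a f := LinearMap.comp (show A →ₗ[k] k from f) (LinearMap.mulRight k a)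

theorem smul_apply (a : A) (f : LeftDual k A) (x : A) : (a • f) x = f (x * a) := rfl

theorem add_apply (f g : LeftDual k A) (x : A) : (f + g) x = f x + g x := rfl

theorem zero_apply (x : A) : (0 : LeftDual k A) x = 0 := rfl

theorem map_add (f : LeftDual k A) (x y : A) : f (x + y) = f x + f y :=
  LinearMap.map_add (show A →ₗ[k] k from f) x y

theorem map_zero (f : LeftDual k A) : f 0 = 0 :=
  LinearMap.map_zero (show A →ₗ[k] k from f)

instance : Module A (LeftDual k A) where
  one_smul f := DFunLike.ext _ _ fun x => by rw [smul_apply, mul_one]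
  mul_smul a b f := DFunLike.ext _ _ fun x => by
    rw [smul_apply, smul_apply, smul_apply, mul_assoc]
  smul_zero a := DFunLike.ext _ _ fun x => by rw [smul_apply, zero_apply, zero_apply]
  smul_add a f g := DFunLike.ext _ _ fun x => by
    rw [smul_apply, add_apply, add_apply, smul_apply, smul_apply]
  add_smul a b f := DFunLike.ext _ _ fun x => by
    rw [smul_apply, mul_add, map_add, add_apply, smul_apply, smul_apply]
  zero_smul f := DFunLike.ext _ _ fun x => by rw [smul_apply, mul_zero, map_zero, zero_apply]

end LeftDual

/-- A `k`-algebra `A` is Frobenius if it is finite dimensional and `A ≃ A*` as left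
`A`-modules. -/
def IsFrobeniusAlgebra (k A : Type*) [CommRing k] [Ring A] [Algebra k A] : Prop :=
  Module.Finite k A ∧ Nonempty (A ≃ₗ[A] LeftDual k A)

/-- `A` is a left `H`-module algebra: `A` is a `k`-algebra and a left `H`-module (with the
same underlying `k`-module), such that `h • 1 = ε(h) 1` and
`h • (a b) = ∑ (h₁ • a) (h₂ • b)`. -/
class LeftModuleAlgebra (k H A : Type*) [CommRing k] [Ring H] [Bialgebra k H] [Ring A]
    [Algebra k A] [Module H A] [IsScalarTower k H A] : Prop where
  smul_one' : ∀ h : H, h • (1 : A) = Coalgebra.counit (R := k) h • (1 : A)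
  smul_mul' : ∀ (h : H) (a b : A), h • (a * b) =
    TensorProduct.lift ((LinearMap.mul k A).compl₁₂
      ((LinearMap.toSpanSingleton H A a).restrictScalars k)
      ((LinearMap.toSpanSingleton H A b).restrictScalars k)) (Coalgebra.comul (R := k) h)

/-- The underlying `k`-module `A ⊗ H` of the smash product `A # H`. -/
def SmashProduct (k A H : Type*) [CommRing k] [Ring A] [Algebra k A] [Ring H] [Algebra k H] :
    Type _ := A ⊗[k] H

namespace SmashProduct

variable {k A H ι : Type*} [CommRing k] [Ring A] [Algebra k A] [Ring H]

noncomputable instance [Algebra k H] : AddCommGroup (SmashProduct k A H) :=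
  inferInstanceAs (AddCommGroup (A ⊗[k] H))

noncomputable instance [Algebra k H] : Module k (SmashProduct k A H) :=
  inferInstanceAs (Module k (A ⊗[k] H))

variable [Bialgebra k H] [Module H A] [IsScalarTower k H A]

variable (k A H) in
/-- The diagonal action of `H` on `A ⊗ H`: `h` acts by `b ⊗ g ↦ ∑ (h₁ • b) ⊗ h₂ g`. -/
noncomputable def diag : H →ₐ[k] Module.End k (A ⊗[k] H) :=
  (Module.endTensorEndAlgHom (R := k) (S := k) (A := k) (M := A) (N := H)).comp
    ((Algebra.TensorProduct.map (Algebra.lsmul k k A) (Algebra.lmul k H)).comp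
      (Bialgebra.comulAlgHom k H))

variable (k A H) in
/-- The bilinear multiplication of `A # H`: `(a # h) (b # g) = ∑ a (h₁ • b) # h₂ g`. -/
noncomputable def mulMap : A ⊗[k] H →ₗ[k] A ⊗[k] H →ₗ[k] A ⊗[k] H :=
  TensorProduct.lift <|
    (LinearMap.mul k (Module.End k (A ⊗[k] H))).compl₁₂
      ((LinearMap.rTensorHom H) ∘ₗ LinearMap.mul k A) (diag k A H).toLinearMap

theorem diag_tmul (h : H) (b : A) (g : H) :
    diag k A H h (b ⊗ₜ[k] g) =
      TensorProduct.map ((LinearMap.toSpanSingleton H A b).restrictScalars k)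
        (LinearMap.mulRight k g) (Coalgebra.comul h) := by
  simp only [diag, AlgHom.comp_apply, Bialgebra.comulAlgHom_apply]
  induction Coalgebra.comul (R := k) h using TensorProduct.induction_on with
  | zero => simp
  | add x y hx hy => simp only [map_add, LinearMap.add_apply, hx, hy]
  | tmul x y => rfl

theorem diag_tmul_repr (h : H) (r : Coalgebra.Repr k h ι) (b : A) (g : H) :
    diag k A H h (b ⊗ₜ[k] g) = ∑ i ∈ r.index, (r.left i • b) ⊗ₜ[k] (r.right i * g) := by
  rw [diag_tmul, ← r.eq]
  simp [map_sum]

theorem mulMap_tmul (a : A) (h : H) :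
    mulMap k A H (a ⊗ₜ[k] h) = (LinearMap.mulLeft k a).rTensor H * diag k A H h := rfl

theorem diag_mul_mulLeft [LeftModuleAlgebra k H A] (h : H) (r : Coalgebra.Repr k h ι) (b : A) :
    diag k A H h * (LinearMap.mulLeft k b).rTensor H =
      ∑ i ∈ r.index, (LinearMap.mulLeft k (r.left i • b)).rTensor H * diag k A H (r.right i) := by
  refine TensorProduct.ext' fun c f => ?_
  let M : H ⊗[k] H →ₗ[k] A := TensorProduct.lift ((LinearMap.mul k A).compl₁₂
      ((LinearMap.toSpanSingleton H A b).restrictScalars k)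
      ((LinearMap.toSpanSingleton H A c).restrictScalars k))
  let T : (H ⊗[k] H) ⊗[k] H →ₗ[k] A ⊗[k] H := TensorProduct.map M (LinearMap.mulRight k f)
  have h1 : (diag k A H h * (LinearMap.mulLeft k b).rTensor H) (c ⊗ₜ[k] f) =
      T ((Coalgebra.comul (R := k) (A := H)).rTensor H (Coalgebra.comul h)) := by
    rw [Module.End.mul_apply, LinearMap.rTensor_tmul, LinearMap.mulLeft_apply, diag_tmul_repr h r,
      ← r.eq]
    simp only [map_sum, LinearMap.rTensor_tmul, T, TensorProduct.map_tmul, M,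
      LinearMap.mulRight_apply, ← LeftModuleAlgebra.smul_mul']
  have h2 : ∀ x y : H, (LinearMap.mulLeft k (x • b)).rTensor H (diag k A H y (c ⊗ₜ[k] f)) =
      T ((TensorProduct.assoc k H H H).symm (x ⊗ₜ[k] Coalgebra.comul y)) := by
    intro x y
    rw [diag_tmul]
    induction Coalgebra.comul (R := k) y using TensorProduct.induction_on with
    | zero => simp
    | add u v hu hv => simp only [map_add, TensorProduct.tmul_add, hu, hv]
    | tmul u v => simp [T, M]
  rw [h1, ← Coalgebra.coassoc_symm_apply, ← r.eq]
  simp only [map_sum, LinearMap.lTensor_tmul, LinearMap.sum_apply, Module.End.mul_apply, h2]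

theorem mulMap_diag [LeftModuleAlgebra k H A] (h : H) (y : A ⊗[k] H) :
    mulMap k A H (diag k A H h y) = diag k A H h * mulMap k A H y := by
  induction y using TensorProduct.induction_on with
  | zero => simp
  | add x y hx hy => simp only [map_add, mul_add, hx, hy]
  | tmul b g =>
    rw [diag_tmul_repr h (Coalgebra.Repr.arbitrary k h), mulMap_tmul, ← mul_assoc,
      diag_mul_mulLeft h (Coalgebra.Repr.arbitrary k h), map_sum, Finset.sum_mul]
    simp only [mulMap_tmul, map_mul, mul_assoc]

theorem mulMap_rTensor (a : A) (y : A ⊗[k] H) :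
    mulMap k A H ((LinearMap.mulLeft k a).rTensor H y) =
      (LinearMap.mulLeft k a).rTensor H * mulMap k A H y := by
  induction y using TensorProduct.induction_on with
  | zero => simp
  | add x y hx hy => simp only [map_add, mul_add, hx, hy]
  | tmul b g =>
    rw [LinearMap.rTensor_tmul, mulMap_tmul, mulMap_tmul, LinearMap.mulLeft_apply,
      LinearMap.mulLeft_mul, LinearMap.rTensor_comp, ← mul_assoc]
    rfl

theorem mulMap_mulMap [LeftModuleAlgebra k H A] (x y : A ⊗[k] H) :
    mulMap k A H (mulMap k A H x y) = mulMap k A H x * mulMap k A H y := by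
  induction x using TensorProduct.induction_on with
  | zero => simp
  | add x y hx hy => simp only [map_add, add_mul, LinearMap.add_apply, hx, hy]
  | tmul a h =>
    rw [mulMap_tmul, Module.End.mul_apply, mulMap_rTensor, mulMap_diag, mul_assoc]

theorem mulMap_one : mulMap k A H (1 ⊗ₜ[k] 1) = 1 := by
  rw [mulMap_tmul, map_one, mul_one, LinearMap.mulLeft_one, LinearMap.rTensor_id]
  rfl

theorem mulMap_apply_one [LeftModuleAlgebra k H A] (x : A ⊗[k] H) :
    mulMap k A H x (1 ⊗ₜ[k] 1) = x := by
  induction x using TensorProduct.induction_on with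
  | zero => simp
  | add x y hx hy => simp only [map_add, LinearMap.add_apply, hx, hy]
  | tmul a h =>
    rw [mulMap_tmul, Module.End.mul_apply, diag_tmul_repr h (Coalgebra.Repr.arbitrary k h)]
    simp only [LeftModuleAlgebra.smul_one' (k := k), TensorProduct.smul_tmul, mul_one,
      ← TensorProduct.tmul_sum, Coalgebra.sum_counit_smul]
    simp

variable [LeftModuleAlgebra k H A]

/-- The smash product `A # H` is a ring with unit `1 # 1` and product
`(a # h) (b # g) = ∑ a (h₁ • b) # h₂ g`. -/
noncomputable instance : Ring (SmashProduct k A H) where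
  __ := (inferInstance : AddCommGroup (SmashProduct k A H))
  mul x y := mulMap k A H x y
  one := (1 : A) ⊗ₜ[k] (1 : H)
  mul_assoc x y z := congrArg (fun f => f z) (mulMap_mulMap (k := k) (A := A) (H := H) x y)
  one_mul x := congrArg (fun f => f x) (mulMap_one (k := k) (A := A) (H := H))
  mul_one x := mulMap_apply_one (k := k) (A := A) (H := H) x
  left_distrib x y z := (mulMap k A H x).map_add y z
  right_distrib x y z := (mulMap k A H).map_add₂ x y z
  zero_mul x := (mulMap k A H).map_zero₂ x
  mul_zero x := (mulMap k A H x).map_zero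

noncomputable instance : Algebra k (SmashProduct k A H) :=
  Algebra.ofModule (fun c x y => (mulMap k A H).map_smul₂ c x y)
    (fun c x y => (mulMap k A H x).map_smul c y)

variable (k) in
/-- The element `a # h` of the smash product. -/
def mk (a : A) (h : H) : SmashProduct k A H := a ⊗ₜ[k] h

theorem mk_mul_mk (a : A) (h : H) (b : A) (g : H) (r : Coalgebra.Repr k h ι) :
    mk k a h * mk k b g = ∑ i ∈ r.index, mk k (a * r.left i • b) (r.right i * g) := by
  change (LinearMap.mulLeft k a).rTensor H (diag k A H h (b ⊗ₜ[k] g)) = _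
  rw [diag_tmul_repr h r, map_sum]
  rfl

theorem one_def : (1 : SmashProduct k A H) = mk k 1 1 := rfl

end SmashProduct

/-! Write `R*` for the dual of `R`. A finite dimensional algebra `R` is Frobenius as soon as some
`R`-linear map `Rⁿ → (R*)ⁿ` with `n > 0` is injective: equality of dimensions makes it an
isomorphism, and powers of a finite dimensional projective module can be cancelled
(`nonempty_linearEquiv_of_pi`). So each direction of the theorem only needs an injection, with `n =
dim H`.

From `A` to `A # H`: let `λ` be a Frobenius form on `A` and `e_i*` the coordinates of a basis of
`H`. The forms `ω_ji(a # l) = ∑ e_j*(l₁) e_i*(l₂) λ(a)` give the map `b ↦ (∑_i b_i • ω_ji)_j`. It is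
injective because the antipode inverts, under convolution, every algebra homomorphism out of `H`.
This is used once for `H → A # H` (`eq_zero_of_algHom_convMul`) and once for the action of `H` on
its dual (`coactTwist_antipode_comp`). Neither integrals nor an inverse antipode are needed here.

The case `A = k` says that `k # H ≃ H` is Frobenius, which yields a nonzero left integral and from
it the bijectivity of the antipode `S` (`antipode_surjective`).

From `A # H` to `A`: as a left `A`-module `A # H` is `Aⁿ`, and a form on `A # H` restricts to `n`
forms `c ↦ f((1 # e_j)(c # 1))` on `A`. These determine `f`, because `S⁻¹` shows that the products
`(1 # h)(c # 1)` span (`mk_eq_sum_inr_mul`). -/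

section FiniteDimensionalModules

/-! ### Cancellation for finite dimensional modules. -/

variable {k R : Type*} [Field k] [Ring R] [Algebra k R]

theorem finite_linearMap_of_isScalarTower {M N : Type*} [AddCommGroup M] [Module k M] [Module R M]
    [IsScalarTower k R M] [Module.Finite k M] [AddCommGroup N] [Module k N] [Module R N]
    [IsScalarTower k R N] [Module.Finite k N] : Module.Finite k (M →ₗ[R] N) :=
  Module.Finite.of_injective (LinearMap.restrictScalarsₗ k R M N k)
    (LinearMap.restrictScalars_injective k)

/-- A maximal submodule exists by finite generation, and the quotient by it is simple. Hence
homomorphisms to the modules `R ⧸ m` detect whether a finitely generated module vanishes. -/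
theorem exists_isCoatom_hom_ne_zero (T : Type*) [AddCommGroup T] [Module R T] [Module.Finite R T]
    [Nontrivial T] : ∃ m : Submodule R R, IsCoatom m ∧ ∃ f : T →ₗ[R] R ⧸ m, f ≠ 0 := by
  obtain ⟨p, hp, -⟩ := (eq_top_or_exists_le_coatom (⊥ : Submodule R T)).resolve_left bot_ne_top
  obtain ⟨m, hm, ⟨e⟩⟩ := isSimpleModule_iff_quot_maximal.1 (isSimpleModule_iff_isCoatom.2 hp)
  refine ⟨m, hm.out, e.toLinearMap ∘ₗ p.mkQ, fun h => hp.1 ?_⟩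
  rw [← p.ker_mkQ, LinearMap.ker_eq_top]
  ext x
  exact e.injective (by simpa using LinearMap.congr_fun h x)

theorem nonempty_linearEquiv_prod_ker {T S : Type*} [AddCommGroup T] [Module R T]
    [IsSemisimpleModule R T] [AddCommGroup S] [Module R S] (f : T →ₗ[R] S)
    (hf : Function.Surjective f) : Nonempty (T ≃ₗ[R] S × LinearMap.ker f) := by
  obtain ⟨q, hq⟩ := exists_isCompl (LinearMap.ker f)
  exact ⟨(Submodule.prodEquivOfIsCompl _ q hq).symm ≪≫ₗ LinearEquiv.prodComm R _ _ ≪≫ₗ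
    LinearEquiv.prodCongr ((Submodule.quotientEquivOfIsCompl _ q hq).symm ≪≫ₗ
      f.quotKerEquivOfSurjective hf) (LinearEquiv.refl R _)⟩

theorem finrank_hom_prod {S T X : Type*} [AddCommGroup S] [Module k S] [Module R S]
    [IsScalarTower k R S] [Module.Finite k S] [AddCommGroup T] [Module k T] [Module R T]
    [IsScalarTower k R T] [Module.Finite k T] [AddCommGroup X] [Module k X] [Module R X]
    [IsScalarTower k R X] [Module.Finite k X] :
    Module.finrank k (S × T →ₗ[R] X) =
      Module.finrank k (S →ₗ[R] X) + Module.finrank k (T →ₗ[R] X) := by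
  have := finite_linearMap_of_isScalarTower (k := k) (R := R) (M := S) (N := X)
  have := finite_linearMap_of_isScalarTower (k := k) (R := R) (M := T) (N := X)
  rw [← Module.finrank_prod]
  exact (LinearMap.coprodEquiv (R := R) (M := S) (M₂ := T) (M₃ := X) k).finrank_eq.symm

theorem finrank_hom_congr {S T X : Type*} [AddCommGroup S] [Module R S]
    [AddCommGroup T] [Module R T] [AddCommGroup X] [Module k X] [Module R X]
    [IsScalarTower k R X] (e : S ≃ₗ[R] T) :
    Module.finrank k (S →ₗ[R] X) = Module.finrank k (T →ₗ[R] X) :=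
  (LinearEquiv.congrLeft X k e).finrank_eq

/-- Finite dimensional semisimple modules are determined by the dimensions of their spaces of
homomorphisms to the simple modules. -/
theorem IsSemisimpleModule.nonempty_linearEquiv_of_finrank_hom_eq [Module.Finite k R]
    {T U : Type*} [AddCommGroup T] [Module k T] [Module R T] [IsScalarTower k R T]
    [Module.Finite k T] [IsSemisimpleModule R T] [AddCommGroup U] [Module k U] [Module R U]
    [IsScalarTower k R U] [Module.Finite k U] [IsSemisimpleModule R U]
    (h : ∀ m : Submodule R R, IsCoatom m →
      Module.finrank k (T →ₗ[R] R ⧸ m) = Module.finrank k (U →ₗ[R] R ⧸ m)) :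
    Nonempty (T ≃ₗ[R] U) := by
  induction hn : Module.finrank k T using Nat.strong_induction_on generalizing T U with
  | _ n ih =>
  have := Module.Finite.of_restrictScalars_finite k R T
  have := Module.Finite.of_restrictScalars_finite k R U
  -- A simple `R ⧸ m` that is a quotient of `T` is also one of `U`. Splitting it off both lowers the
  -- dimension and lowers both Hom-dimensions by the same amount.
  by_cases hm : ∃ m : Submodule R R, IsCoatom m ∧ Module.finrank k (T →ₗ[R] R ⧸ m) ≠ 0
  · obtain ⟨m, hm, h0⟩ := hm
    have : IsSimpleModule R (R ⧸ m) := isSimpleModule_iff_isCoatom.2 hm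
    have : Nontrivial (T →ₗ[R] R ⧸ m) := Module.nontrivial_of_finrank_pos (Nat.pos_of_ne_zero h0)
    have : Nontrivial (U →ₗ[R] R ⧸ m) :=
      Module.nontrivial_of_finrank_pos (Nat.pos_of_ne_zero (h m hm ▸ h0))
    obtain ⟨f, hf⟩ := exists_ne (0 : T →ₗ[R] R ⧸ m)
    obtain ⟨g, hg⟩ := exists_ne (0 : U →ₗ[R] R ⧸ m)
    obtain ⟨e⟩ := nonempty_linearEquiv_prod_ker f (LinearMap.surjective_of_ne_zero hf)
    obtain ⟨e'⟩ := nonempty_linearEquiv_prod_ker g (LinearMap.surjective_of_ne_zero hg)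
    have : Module.Finite k (LinearMap.ker f) :=
      Module.Finite.of_injective ((LinearMap.ker f).subtype.restrictScalars k)
        Subtype.val_injective
    have : Module.Finite k (LinearMap.ker g) :=
      Module.Finite.of_injective ((LinearMap.ker g).subtype.restrictScalars k)
        Subtype.val_injective
    have : Nontrivial (R ⧸ m) := IsSimpleModule.nontrivial R _
    obtain ⟨i⟩ := ih (Module.finrank k (LinearMap.ker f)) (by
        rw [← hn, (e.restrictScalars k).finrank_eq, Module.finrank_prod]
        have := Module.finrank_pos (R := k) (M := R ⧸ m)
        omega) (T := LinearMap.ker f) (U := LinearMap.ker g) (fun p hp => by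
        have := h p hp
        rw [finrank_hom_congr e, finrank_hom_congr e', finrank_hom_prod, finrank_hom_prod] at this
        exact Nat.add_left_cancel this) rfl
    exact ⟨e ≪≫ₗ LinearEquiv.prodCongr (LinearEquiv.refl R _) i ≪≫ₗ e'.symm⟩
  · push Not at hm
    have hT : Subsingleton T := by
      by_contra hT
      rw [not_subsingleton_iff_nontrivial] at hT
      obtain ⟨m, hm', f, hf⟩ := exists_isCoatom_hom_ne_zero (R := R) T
      have := finite_linearMap_of_isScalarTower (k := k) (R := R) (M := T) (N := R ⧸ m)
      have := Module.finrank_zero_iff.1 (hm m hm')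
      exact hf (Subsingleton.elim _ _)
    have hU : Subsingleton U := by
      by_contra hU
      rw [not_subsingleton_iff_nontrivial] at hU
      obtain ⟨m, hm', f, hf⟩ := exists_isCoatom_hom_ne_zero (R := R) U
      have := finite_linearMap_of_isScalarTower (k := k) (R := R) (M := U) (N := R ⧸ m)
      have := Module.finrank_zero_iff.1 ((h m hm').symm.trans (hm m hm'))
      exact hf (Subsingleton.elim _ _)
    exact ⟨0, 0, fun _ => Subsingleton.elim _ _, fun _ => Subsingleton.elim _ _⟩

/-- The top of a module has the same homomorphisms to simple modules. -/
theorem finrank_hom_quotient_jacobson {M S : Type*} [AddCommGroup M] [Module R M]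
    [AddCommGroup S] [Module k S] [Module R S] [IsScalarTower k R S] [IsSimpleModule R S] :
    Module.finrank k (M ⧸ Module.jacobson R M →ₗ[R] S) = Module.finrank k (M →ₗ[R] S) :=
  LinearEquiv.finrank_eq <| LinearEquiv.ofBijective
    (LinearMap.lcomp k S (Module.jacobson R M).mkQ)
    ⟨fun _ _ h => Submodule.linearMap_qext _ h, fun f =>
      have h := IsSemisimpleModule.jacobson_le_ker R R M S f
      ⟨(Module.jacobson R M).liftQ f h, (Module.jacobson R M).liftQ_mkQ f h⟩⟩

theorem finrank_pi_hom {ι M X : Type*} [Fintype ι] [AddCommGroup M] [Module k M] [Module R M]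
    [IsScalarTower k R M] [Module.Finite k M] [AddCommGroup X] [Module k X] [Module R X]
    [IsScalarTower k R X] [Module.Finite k X] :
    Module.finrank k ((ι → M) →ₗ[R] X) = Fintype.card ι * Module.finrank k (M →ₗ[R] X) := by
  classical
  have := finite_linearMap_of_isScalarTower (k := k) (R := R) (M := M) (N := X)
  rw [← (LinearMap.lsum R (fun _ : ι => M) k (M := X)).finrank_eq, Module.finrank_pi_fintype,
    Finset.sum_const, Finset.card_univ, smul_eq_mul]

/-- Cancellation of powers against a finite dimensional projective module. -/
theorem nonempty_linearEquiv_of_pi [Module.Finite k R] {ι M N : Type*} [Finite ι] [Nonempty ι]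
    [AddCommGroup M] [Module k M] [Module R M] [IsScalarTower k R M] [Module.Finite k M]
    [Module.Projective R M]
    [AddCommGroup N] [Module k N] [Module R N] [IsScalarTower k R N] [Module.Finite k N]
    (e : (ι → M) ≃ₗ[R] (ι → N)) : Nonempty (M ≃ₗ[R] N) := by
  have := Fintype.ofFinite ι
  have hι : 0 < Fintype.card ι := Fintype.card_pos
  have : IsArtinianRing R := IsArtinianRing.of_finite k R
  have := Module.Finite.of_restrictScalars_finite k R M
  have := Module.Finite.of_restrictScalars_finite k R N
  have : IsSemisimpleModule R (M ⧸ Module.jacobson R M) :=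
    (IsArtinian.isSemisimpleModule_iff_jacobson R _).2 (Module.jacobson_quotient_jacobson R M)
  have : IsSemisimpleModule R (N ⧸ Module.jacobson R N) :=
    (IsArtinian.isSemisimpleModule_iff_jacobson R _).2 (Module.jacobson_quotient_jacobson R N)
  have hdim : Module.finrank k M = Module.finrank k N := by
    have := (e.restrictScalars k).finrank_eq
    simp only [Module.finrank_pi_fintype, Finset.sum_const, Finset.card_univ, smul_eq_mul] at this
    exact Nat.eq_of_mul_eq_mul_left hι this
  -- The tops of `M` and `N` are isomorphic: Hom-dimensions of powers are `card ι` times those of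
  -- `M` and `N`, and this factor cancels.
  obtain ⟨i⟩ := IsSemisimpleModule.nonempty_linearEquiv_of_finrank_hom_eq (k := k)
    (T := M ⧸ Module.jacobson R M) (U := N ⧸ Module.jacobson R N) (R := R) (fun m hm => by
      have : IsSimpleModule R (R ⧸ m) := isSimpleModule_iff_isCoatom.2 hm
      rw [finrank_hom_quotient_jacobson, finrank_hom_quotient_jacobson]
      have := finrank_hom_congr (k := k) (X := R ⧸ m) e
      rw [finrank_pi_hom, finrank_pi_hom] at this
      exact Nat.eq_of_mul_eq_mul_left hι this)
  -- Projectivity of `M` lifts the isomorphism of tops to `f : M → N`.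
  obtain ⟨f, hf⟩ := Module.projective_lifting_property (Module.jacobson R N).mkQ
    (i.toLinearMap ∘ₗ (Module.jacobson R M).mkQ) (Submodule.mkQ_surjective _)
  -- Nakayama: a maximal submodule containing the range of `f` also contains the radical, and the
  -- range and the radical together span `N`.
  have hsurj : LinearMap.range f = ⊤ := by
    by_contra hne
    obtain ⟨p, hp, hfp⟩ := (eq_top_or_exists_le_coatom (LinearMap.range f)).resolve_left hne
    refine hp.1 (eq_top_iff.2 fun x _ => ?_)
    obtain ⟨y, hy⟩ := Submodule.mkQ_surjective _ (i.symm ((Module.jacobson R N).mkQ x))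
    have h1 : (Module.jacobson R N).mkQ (f y) = (Module.jacobson R N).mkQ x := by
      rw [← LinearMap.comp_apply, hf]; simp [hy]
    have h2 : x - f y ∈ p := (sInf_le hp : Module.jacobson R N ≤ p)
      ((Submodule.Quotient.eq _).1 h1.symm)
    simpa using p.add_mem h2 (hfp ⟨y, rfl⟩)
  have hs : Function.Surjective f := LinearMap.range_eq_top.1 hsurj
  exact ⟨LinearEquiv.ofBijective f
    ⟨(LinearMap.injective_iff_surjective_of_finrank_eq_finrank (f := f.restrictScalars k) hdim).2 hs,
      hs⟩⟩

end FiniteDimensionalModules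

theorem isFrobeniusAlgebra_self (k : Type*) [Field k] : IsFrobeniusAlgebra k k := by
  let u : LeftDual k k := (LinearMap.id : k →ₗ[k] k)
  refine ⟨inferInstance, ⟨LinearEquiv.ofBijective (LinearMap.toSpanSingleton k (LeftDual k k) u)
    ⟨(injective_iff_map_eq_zero _).2 fun b hb => ?_, fun f => ⟨f 1, ?_⟩⟩⟩⟩
  · have h : (1 : k) * b = 0 := DFunLike.congr_fun hb (1 : k)
    simpa using h
  · refine DFunLike.ext _ _ fun x => ?_
    change x * f 1 = f x
    exact (LinearMap.map_smul (show k →ₗ[k] k from f) x 1).symm.trans (congrArg f (mul_one x))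

namespace LeftDual

variable {k A : Type*} [Field k] [Ring A] [Algebra k A]

noncomputable instance : Module k (LeftDual k A) := inferInstanceAs (Module k (A →ₗ[k] k))

instance [Module.Finite k A] : Module.Finite k (LeftDual k A) :=
  inferInstanceAs (Module.Finite k (A →ₗ[k] k))

theorem smul_apply' (c : k) (f : LeftDual k A) (x : A) : (c • f) x = c * f x := rfl

instance : IsScalarTower k A (LeftDual k A) where
  smul_assoc c a f := DFunLike.ext _ _ fun x => by
    rw [smul_apply, smul_apply', smul_apply, mul_smul_comm]
    exact LinearMap.map_smul (show A →ₗ[k] k from f) _ _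

theorem finrank_eq : Module.finrank k (LeftDual k A) = Module.finrank k A :=
  Subspace.dual_finrank_eq

end LeftDual

/-- Both sides have the same dimension, so `f` is bijective, and cancellation applies because `R` is
projective over itself. -/
theorem isFrobeniusAlgebra_of_injective_pi {k R ι : Type*} [Field k] [Ring R] [Algebra k R]
    [Module.Finite k R] [Finite ι] [Nonempty ι] (f : (ι → R) →ₗ[R] (ι → LeftDual k R))
    (hf : Function.Injective f) : IsFrobeniusAlgebra k R := by
  have := Fintype.ofFinite ι
  have hd : Module.finrank k (ι → R) = Module.finrank k (ι → LeftDual k R) := by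
    simp [Module.finrank_pi_fintype, LeftDual.finrank_eq]
  have hs : Function.Surjective (f.restrictScalars k) :=
    (LinearMap.injective_iff_surjective_of_finrank_eq_finrank hd).1 hf
  exact ⟨inferInstance, nonempty_linearEquiv_of_pi (k := k) (LinearEquiv.ofBijective f ⟨hf, hs⟩)⟩

/-! ### Convolution and twisting by the coproduct. -/

section TensorBasis

variable {k M N ι : Type*} [Field k] [AddCommGroup M] [Module k M] [AddCommGroup N] [Module k N]

theorem sum_rid_lTensor_coord_tmul [Fintype ι] (e : Module.Basis ι k N) (w : M ⊗[k] N) :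
    ∑ j, TensorProduct.rid k M ((e.coord j).lTensor M w) ⊗ₜ[k] e j = w := by
  induction w using TensorProduct.induction_on with
  | zero => simp
  | add x y hx hy => simp only [map_add, TensorProduct.add_tmul, Finset.sum_add_distrib, hx, hy]
  | tmul m n =>
    simp only [LinearMap.lTensor_tmul, TensorProduct.rid_tmul, TensorProduct.smul_tmul,
      ← TensorProduct.tmul_sum, Module.Basis.coord_apply, e.sum_repr]

theorem tensor_eq_zero_of_coord [Finite ι] (e : Module.Basis ι k N) (w : M ⊗[k] N)
    (h : ∀ j, TensorProduct.rid k M ((e.coord j).lTensor M w) = 0) : w = 0 := by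
  have := Fintype.ofFinite ι
  rw [← sum_rid_lTensor_coord_tmul e w]
  simp [h]

end TensorBasis

section Contraction

open Coalgebra WithConv HopfAlgebra

variable {k H : Type*} [Field k] [Ring H]

/-- The right coregular action `l ↦ ∑ f(l₂) l₁` of a linear form `f` on a coalgebra. -/
noncomputable def coregularRight [Algebra k H] [Coalgebra k H] :
    (H →ₗ[k] k) →ₗ[k] H →ₗ[k] H where
  toFun f := (TensorProduct.rid k H).toLinearMap ∘ₗ f.lTensor H ∘ₗ comul
  map_add' f g := by simp [LinearMap.lTensor_add, LinearMap.add_comp, LinearMap.comp_add]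
  map_smul' c f := by simp [LinearMap.lTensor_smul, LinearMap.smul_comp, LinearMap.comp_smul]

theorem coregularRight_apply [Algebra k H] [Coalgebra k H] (f : H →ₗ[k] k) (l : H) :
    coregularRight f l = TensorProduct.rid k H (f.lTensor H (comul l)) := rfl

theorem coregularRight_mul [Bialgebra k H] {κ : Type*} (f : H →ₗ[k] k) (h l : H)
    (r : Repr k h κ) : coregularRight f (h * l) =
      ∑ i ∈ r.index, r.left i * coregularRight (f ∘ₗ LinearMap.mulLeft k (r.right i)) l := by
  simp only [coregularRight_apply, Bialgebra.comul_mul]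
  rw [← r.eq, ← (Repr.arbitrary k l).eq, Finset.sum_mul, map_sum, map_sum]
  refine Finset.sum_congr rfl fun i _ => ?_
  simp [Finset.mul_sum]

/-- Composition with an algebra homomorphism respects convolution, so this is the image under `j` of
`S * id = 1`. -/
theorem antipode_comp_convMul [HopfAlgebra k H] {D : Type*} [Ring D] [Algebra k D]
    (j : H →ₐ[k] D) : toConv (j.toLinearMap ∘ₗ antipode k) * toConv j.toLinearMap = 1 := by
  have := LinearMap.algHom_comp_convMul_distrib j (toConv (antipode k (A := H)))
    (toConv LinearMap.id)
  rw [LinearMap.antipode_mul_id] at this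
  apply WithConv.ofConv_injective
  refine this.symm.trans ?_
  ext x
  simp

/-- If `D(x) = ∑ j(x₁) F(x₂)` vanishes for an algebra homomorphism `j`, so does `F`. -/
theorem eq_zero_of_algHom_convMul [HopfAlgebra k H] {D : Type*} [Ring D] [Algebra k D]
    (j : H →ₐ[k] D) (F : H →ₗ[k] D) (h : toConv j.toLinearMap * toConv F = 0) : F = 0 := by
  have : toConv F = 0 := by
    rw [← one_mul (toConv F), ← antipode_comp_convMul j, mul_assoc, h, mul_zero]
  exact congrArg WithConv.ofConv this

/-- The map `l ⊗ v ↦ ∑ l₁ ⊗ φ(l₂) v`. -/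
noncomputable def coactTwist [Algebra k H] [Coalgebra k H] {V : Type*} [AddCommGroup V]
    [Module k V] (φ : H →ₗ[k] Module.End k V) : H ⊗[k] V →ₗ[k] H ⊗[k] V :=
  (TensorProduct.lift φ).lTensor H ∘ₗ (TensorProduct.assoc k H H V).toLinearMap ∘ₗ
    (comul (R := k) (A := H)).rTensor V

theorem coactTwist_tmul [Algebra k H] [Coalgebra k H] {V κ : Type*} [AddCommGroup V]
    [Module k V] (φ : H →ₗ[k] Module.End k V) (l : H) (v : V) (r : Repr k l κ) :
    coactTwist φ (l ⊗ₜ v) = ∑ i ∈ r.index, r.left i ⊗ₜ[k] φ (r.right i) v := by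
  simp [coactTwist, ← r.eq, TensorProduct.sum_tmul]

theorem coactTwist_one [Bialgebra k H] {V : Type*} [AddCommGroup V] [Module k V] :
    coactTwist (1 : WithConv (H →ₗ[k] Module.End k V)).ofConv = LinearMap.id := by
  refine TensorProduct.ext' fun l v => ?_
  rw [coactTwist_tmul _ _ _ (Repr.arbitrary k l)]
  simp only [LinearMap.convOne_def, ofConv_toConv, LinearMap.comp_apply, Algebra.linearMap_apply,
    Module.algebraMap_end_apply, LinearMap.id_apply, ← TensorProduct.smul_tmul]
  have := congrArg (TensorProduct.rid k H) (sum_tmul_counit_eq (Repr.arbitrary k l))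
  simp only [map_sum, TensorProduct.rid_tmul, one_smul] at this
  rw [← TensorProduct.sum_tmul, this]

/-- By coassociativity both sides send `l ⊗ v` to `∑ l₁ ⊗ φ(l₂) ψ(l₃) v`. -/
theorem coactTwist_comp [Bialgebra k H] {V : Type*} [AddCommGroup V] [Module k V]
    (φ ψ : WithConv (H →ₗ[k] Module.End k V)) :
    coactTwist φ.ofConv ∘ₗ coactTwist ψ.ofConv = coactTwist (φ * ψ).ofConv := by
  refine TensorProduct.ext' fun l v => ?_
  let T : H ⊗[k] (H ⊗[k] H) →ₗ[k] H ⊗[k] V := LinearMap.lTensor H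
    (LinearMap.applyₗ v ∘ₗ LinearMap.mul' k _ ∘ₗ TensorProduct.map φ.ofConv ψ.ofConv)
  let r := Repr.arbitrary k l
  have h1 : ∀ x y : H, coactTwist φ.ofConv (x ⊗ₜ ψ.ofConv y v) =
      T (TensorProduct.assoc k H H H (comul x ⊗ₜ y)) := fun x y => by
    rw [coactTwist_tmul _ _ _ (Repr.arbitrary k x), ← (Repr.arbitrary k x).eq]
    simp [T, TensorProduct.sum_tmul]
  rw [LinearMap.comp_apply, coactTwist_tmul _ _ _ r, map_sum, coactTwist_tmul _ _ _ r]
  simp only [h1, ← map_sum]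
  have h2 : ∑ i ∈ r.index, comul (R := k) (r.left i) ⊗ₜ[k] r.right i =
      (comul (R := k) (A := H)).rTensor H (comul l) := by
    simp [← r.eq]
  rw [h2, coassoc_apply, ← r.eq]
  simp [T, LinearMap.convMul_def]

theorem coactTwist_antipode_comp [HopfAlgebra k H] {V : Type*} [AddCommGroup V] [Module k V]
    (ρ : H →ₐ[k] Module.End k V) :
    coactTwist (ρ.toLinearMap ∘ₗ antipode k) ∘ₗ coactTwist ρ.toLinearMap = LinearMap.id := by
  have := coactTwist_comp (toConv (ρ.toLinearMap ∘ₗ antipode k)) (toConv ρ.toLinearMap)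
  rwa [antipode_comp_convMul, coactTwist_one] at this

end Contraction

section Contraction

open Coalgebra WithConv HopfAlgebra

variable {k A H : Type*} [Field k] [AddCommGroup A] [Module k A] [Ring H] [HopfAlgebra k H]

/-- If `∑ᵢ f_i(z (bᵢ)₁) (bᵢ)₀ = 0` for all `z`, where the `f_i` are a dual basis, then `bᵢ = 0`. -/
theorem eq_zero_of_sum_lTensor_coregularRight {ι : Type*} [Fintype ι] (e : Module.Basis ι k H)
    (b : ι → A ⊗[k] H)
    (h : ∀ z, ∑ i, (coregularRight (e.coord i ∘ₗ LinearMap.mulLeft k z)).lTensor A (b i) = 0) :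
    b = 0 := by
  classical
  -- Here `x` acts on forms by `f ↦ f(· x)`. Twisting `l ⊗ f` by `ρ` gives `∑ l₁ ⊗ f(· l₂)`, whose
  -- value at `z` is `∑ f(z l₂) l₁`. The hypothesis thus says that the twist of `β` vanishes at
  -- every `z`.
  let ρ : H →ₐ[k] Module.End k (Module.Dual k H) := AlgHom.ofLinearMap
    (LinearMap.mk₂ k (fun x f => f ∘ₗ LinearMap.mulRight k x)
      (fun x y f => by ext; simp [mul_add]) (fun c x f => by ext; simp)
      (fun x f g => by ext; simp) (fun c x f => by ext; simp))
    (by ext; simp) (fun x y => by ext; simp [mul_assoc])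
  have hφ : coactTwist (ρ.toLinearMap ∘ₗ antipode k) ∘ₗ coactTwist ρ.toLinearMap =
      LinearMap.id := coactTwist_antipode_comp ρ
  let β : (A ⊗[k] H) ⊗[k] Module.Dual k H := ∑ i, b i ⊗ₜ e.coord i
  let ev (z : H) : A ⊗[k] (H ⊗[k] Module.Dual k H) →ₗ[k] A ⊗[k] H := LinearMap.lTensor A
    ((TensorProduct.rid k H).toLinearMap ∘ₗ (Module.Dual.eval k H z).lTensor H)
  have key : ∀ z (w : A ⊗[k] H) (f : Module.Dual k H),
      ev z ((coactTwist ρ.toLinearMap).lTensor A (TensorProduct.assoc k A H _ (w ⊗ₜ f))) =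
        (coregularRight (f ∘ₗ LinearMap.mulLeft k z)).lTensor A w := by
    intro z w f
    induction w using TensorProduct.induction_on with
    | zero => simp
    | add x y hx hy =>
      rw [TensorProduct.add_tmul]
      simp only [map_add, hx, hy]
    | tmul a l =>
      have : TensorProduct.rid k H ((Module.Dual.eval k H z).lTensor H
          (coactTwist ρ.toLinearMap (l ⊗ₜ f))) = coregularRight (f ∘ₗ LinearMap.mulLeft k z) l := by
        rw [coactTwist_tmul _ _ _ (Repr.arbitrary k l), coregularRight_apply,
          ← (Repr.arbitrary k l).eq]
        simp [ρ]
      exact congrArg (fun t => a ⊗ₜ[k] t) this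
  -- Evaluation at the basis vectors `e j` already gives the coordinates along the dual basis.
  have zero : ∀ w : A ⊗[k] (H ⊗[k] Module.Dual k H), (∀ z, ev z w = 0) → w = 0 := by
    intro w hw
    refine (TensorProduct.assoc k A H (Module.Dual k H)).symm.injective ?_
    rw [map_zero]
    refine tensor_eq_zero_of_coord e.dualBasis _ fun j => ?_
    rw [← hw (e j)]
    clear hw
    generalize hv : (TensorProduct.assoc k A H (Module.Dual k H)).symm w = v
    rw [LinearEquiv.symm_apply_eq] at hv
    subst hv
    induction v using TensorProduct.induction_on with
    | zero => simp
    | add x y hx hy => simp only [map_add, hx, hy]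
    | tmul x f =>
      induction x using TensorProduct.induction_on with
      | zero => simp
      | add x y hx hy => simp only [TensorProduct.add_tmul, map_add, hx, hy]
      | tmul a l => simp [ev]
  have h1 : (coactTwist ρ.toLinearMap).lTensor A (TensorProduct.assoc k A H _ β) = 0 :=
    zero _ fun z => by
      simp only [β, map_sum, key]
      exact h z
  have h2 : TensorProduct.assoc k A H _ β = 0 := by
    have := congrArg (LinearMap.lTensor A
      (coactTwist (ρ.toLinearMap ∘ₗ antipode k))) h1
    rwa [map_zero, ← LinearMap.comp_apply, ← LinearMap.lTensor_comp, hφ, LinearMap.lTensor_id,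
      LinearMap.id_apply] at this
  have h3 : β = 0 := (LinearEquiv.map_eq_zero_iff _).1 h2
  funext j
  have h4 := congrArg (fun w => TensorProduct.rid k _ ((e.dualBasis.coord j).lTensor _ w)) h3
  simpa [β, Finsupp.single_apply] using h4

end Contraction

/-! ### Coregular maps on the smash product. -/

namespace SmashProduct

open Coalgebra WithConv HopfAlgebra

variable {k A H : Type*} [Field k] [Ring A] [Algebra k A] [Ring H]

variable [Bialgebra k H]

theorem induction_on {p : SmashProduct k A H → Prop} (x : SmashProduct k A H) (zero : p 0)
    (mk : ∀ a h, p (mk k a h)) (add : ∀ x y, p x → p y → p (x + y)) : p x :=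
  TensorProduct.induction_on (motive := p) x zero mk add

variable [Module H A] [IsScalarTower k H A]

variable [LeftModuleAlgebra k H A]

theorem mk_one_mul_mk (a b : A) (g : H) : mk k a (1 : H) * mk k b g = mk k (a * b) g := by
  change (LinearMap.mulLeft k a).rTensor H (diag k A H 1 (b ⊗ₜ[k] g)) = _
  rw [map_one]
  rfl

theorem one_mk_mul_one_mk (h g : H) : mk k (1 : A) h * mk k 1 g = mk k 1 (h * g) := by
  rw [mk_mul_mk 1 h 1 g (Repr.arbitrary k h)]
  simp only [LeftModuleAlgebra.smul_one' (k := k), one_mul]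
  change ∑ i ∈ _, (_ • (1 : A)) ⊗ₜ[k] (_ : H) = (1 : A) ⊗ₜ[k] (h * g)
  simp only [TensorProduct.smul_tmul, ← TensorProduct.tmul_sum, ← smul_mul_assoc,
    ← Finset.sum_mul, sum_counit_smul]

variable (k A H) in
/-- The embedding `h ↦ 1 # h` of `H` in `A # H`. -/
noncomputable def inr : H →ₐ[k] SmashProduct k A H :=
  AlgHom.ofLinearMap (TensorProduct.mk k A H 1) rfl fun h g => (one_mk_mul_one_mk h g).symm

theorem inr_apply (h : H) : inr k A H h = mk k 1 h := rfl

theorem inr_mul_mk {κ : Type*} (h : H) (b : A) (g : H) (r : Repr k h κ) :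
    inr k A H h * mk k b g = ∑ i ∈ r.index, mk k (r.left i • b) (r.right i * g) := by
  rw [inr_apply, mk_mul_mk 1 h b g r]
  simp only [one_mul]

/-- The map `a # l ↦ ∑ f(l₂) a # l₁` on the smash product. -/
noncomputable def coregular : (H →ₗ[k] k) →ₗ[k] SmashProduct k A H →ₗ[k] SmashProduct k A H :=
  LinearMap.lTensorHom A ∘ₗ coregularRight

theorem coregular_mk (f : H →ₗ[k] k) (a : A) (l : H) :
    coregular f (mk k a l) = mk k a (coregularRight f l) := rfl

theorem coregular_mk_one_mul (f : H →ₗ[k] k) (a : A) (b : SmashProduct k A H) :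
    coregular f (mk k a 1 * b) = mk k a 1 * coregular f b := by
  induction b using SmashProduct.induction_on with
  | zero => simp
  | add x y hx hy => simp only [mul_add, map_add, hx, hy]
  | mk c l => simp only [mk_one_mul_mk, coregular_mk]

/-- For `b = c # l` both sides are `∑ f(x₃ l₂) (x₁ • c) # x₂ l₁`. The convolution form isolates the
factor `1 # x₁`, which the antipode can then remove. -/
theorem coregular_inr_mul (f : H →ₗ[k] k) (b : SmashProduct k A H) (x : H) :
    coregular f (inr k A H x * b) = (toConv (inr k A H).toLinearMap *
      toConv (coregular.flip b ∘ₗ (LinearMap.mul k H).compr₂ f)) x := by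
  induction b using SmashProduct.induction_on with
  | zero => simp
  | add b c hb hc =>
    simp only [mul_add, map_add, hb, hc, LinearMap.add_comp, toConv_add]
    rfl
  | mk c l =>
    let r := Repr.arbitrary k x
    let G : H ⊗[k] H →ₗ[k] H := LinearMap.mul' k H ∘ₗ
      (coregularRight.flip l ∘ₗ (LinearMap.mul k H).compr₂ f).lTensor H
    let T : H ⊗[k] (H ⊗[k] H) →ₗ[k] SmashProduct k A H :=
      TensorProduct.map ((LinearMap.toSpanSingleton H A c).restrictScalars k) G
    have hG : ∀ y, G (comul y) = coregularRight f (y * l) := fun y => by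
      rw [coregularRight_mul f y l (Repr.arbitrary k y), ← (Repr.arbitrary k y).eq]
      simp only [map_sum, G]
      rfl
    have hT : ∀ y z, T (TensorProduct.assoc k H H H (comul y ⊗ₜ z)) =
        inr k A H y * mk k c (coregularRight (f ∘ₗ LinearMap.mulLeft k z) l) := fun y z => by
      rw [inr_mul_mk _ _ _ (Repr.arbitrary k y), ← (Repr.arbitrary k y).eq]
      simp only [TensorProduct.sum_tmul, map_sum]
      rfl
    rw [r.convMul_apply, inr_mul_mk x c l r, map_sum]
    simp only [coregular_mk, ← hG]
    have h1 : ∑ i ∈ r.index, mk k (r.left i • c) (G (comul (r.right i))) =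
        T ((comul (R := k) (A := H)).lTensor H (comul x)) := by
      rw [← r.eq]
      simp only [map_sum]
      rfl
    have h2 : (comul (R := k) (A := H)).rTensor H (comul x) =
        ∑ i ∈ r.index, comul (R := k) (r.left i) ⊗ₜ[k] r.right i := by
      simp [← r.eq]
    rw [h1, ← coassoc_apply, h2, map_sum, map_sum]
    exact Finset.sum_congr rfl fun i _ => hT _ _

end SmashProduct

/-! ### From `A` to `A # H`. -/

namespace SmashProduct

open Coalgebra WithConv HopfAlgebra

section

variable {k A H : Type*} [Field k] [Ring A] [Algebra k A] [Module.Finite k A] [Ring H]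
  [Bialgebra k H] [Module.Finite k H] [Module H A] [IsScalarTower k H A] [LeftModuleAlgebra k H A]

instance : Module.Finite k (SmashProduct k A H) := inferInstanceAs (Module.Finite k (A ⊗[k] H))

end

variable {k A H : Type*} [Field k] [Ring A] [Algebra k A] [Ring H] [HopfAlgebra k H]
  [Module H A] [IsScalarTower k H A] [LeftModuleAlgebra k H A]

/-- The map `a # h ↦ f(h) a`. -/
noncomputable def evalRight (f : H →ₗ[k] k) : SmashProduct k A H →ₗ[k] A :=
  (TensorProduct.rid k A).toLinearMap ∘ₗ f.lTensor A

theorem evalRight_mk (f : H →ₗ[k] k) (a : A) (h : H) : evalRight f (mk k a h) = f h • a := by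
  change TensorProduct.rid k A (f.lTensor A (a ⊗ₜ[k] h)) = _
  simp

theorem evalRight_mk_one_mul (f : H →ₗ[k] k) (a : A) (x : SmashProduct k A H) :
    evalRight f (mk k a 1 * x) = a * evalRight f x := by
  induction x using SmashProduct.induction_on with
  | zero => simp
  | add x y hx hy => simp only [mul_add, map_add, hx, hy]
  | mk c l => simp only [mk_one_mul_mk, evalRight_mk, mul_smul_comm]

/-- The hypothesis is that the convolution of `inr` with `F` vanishes. Cancelling `inr` leaves `F z
= 0` for all `z`, and the invertible twist does the rest. -/
theorem eq_zero_of_sum_coregular_mul {ι : Type*} [Fintype ι] (e : Module.Basis ι k H)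
    (b : ι → SmashProduct k A H)
    (h : ∀ x, ∑ i, coregular (e.coord i) (inr k A H x * b i) = 0) : b = 0 := by
  let F : H →ₗ[k] SmashProduct k A H :=
    ∑ i, coregular.flip (b i) ∘ₗ (LinearMap.mul k H).compr₂ (e.coord i)
  have hF : F = 0 := by
    refine eq_zero_of_algHom_convMul (inr k A H) F (WithConv.ext (LinearMap.ext fun x => ?_))
    rw [toConv_sum, Finset.mul_sum, ofConv_sum, LinearMap.sum_apply]
    simp only [← coregular_inr_mul, h]
    rfl
  refine eq_zero_of_sum_lTensor_coregularRight e b fun z => ?_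
  have := LinearMap.congr_fun hF z
  simp only [F, LinearMap.sum_apply] at this
  exact this

theorem isFrobeniusAlgebra_of_left [Module.Finite k A] [Module.Finite k H]
    (hA : IsFrobeniusAlgebra k A) : IsFrobeniusAlgebra k (SmashProduct k A H) := by
  obtain ⟨-, ⟨φ⟩⟩ := hA
  have : Nontrivial H := (Bialgebra.counitAlgHom k H).toRingHom.domain_nontrivial
  let e := Module.finBasis k H
  have : Nonempty (Fin (Module.finrank k H)) := e.index_nonempty
  let lam : A →ₗ[k] k := φ 1
  -- Since `φ a = a • φ 1`, the value of `φ a` at `x` is `lam (x * a)`.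
  have hlam : ∀ a, (∀ x, lam (x * a) = 0) → a = 0 := fun a h => by
    refine φ.injective (DFunLike.ext _ _ fun x => ?_)
    rw [map_zero, ← mul_one a, ← smul_eq_mul, map_smul]
    exact h x
  let ω (j i) : LeftDual k (SmashProduct k A H) :=
    lam ∘ₗ evalRight (e.coord j) ∘ₗ coregular (e.coord i)
  let Ψ : (Fin (Module.finrank k H) → SmashProduct k A H) →ₗ[SmashProduct k A H]
      (Fin (Module.finrank k H) → LeftDual k (SmashProduct k A H)) :=
    LinearMap.pi fun j => ∑ i, LinearMap.toSpanSingleton _ _ (ω j i) ∘ₗ LinearMap.proj i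
  refine isFrobeniusAlgebra_of_injective_pi Ψ ((injective_iff_map_eq_zero _).2 fun b hb => ?_)
  have h1 : ∀ j y, lam (evalRight (e.coord j) (∑ i, coregular (e.coord i) (y * b i))) = 0 := by
    intro j y
    have h2 : (∑ i, b i • ω j i) y = 0 := by
      have := DFunLike.congr_fun (congrFun hb j) y
      simpa [Ψ, LeftDual.zero_apply] using this
    have h3 : ∀ s : Finset (Fin (Module.finrank k H)), (∑ i ∈ s, b i • ω j i) y =
        lam (evalRight (e.coord j) (∑ i ∈ s, coregular (e.coord i) (y * b i))) := by
      intro s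
      induction s using Finset.cons_induction with
      | empty => simp [LeftDual.zero_apply]
      | cons i s hi ih =>
        rw [Finset.sum_cons, Finset.sum_cons, LeftDual.add_apply, ih, map_add, map_add]
        rfl
    rw [← h3, h2]
  -- Test at `y = (a # 1)(1 # x)`: the factor `a` passes through the left `A`-linear maps, and
  -- nondegeneracy of `lam` removes `lam`.
  refine eq_zero_of_sum_coregular_mul e b fun x => tensor_eq_zero_of_coord e _ fun j => hlam _
    fun a => ?_
  have := h1 j (mk k a 1 * inr k A H x)
  simp only [mul_assoc, coregular_mk_one_mul, ← Finset.mul_sum, evalRight_mk_one_mul] at this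
  exact this

end SmashProduct

/-! ### Left integrals. -/

namespace HopfAlgebra

open Coalgebra

variable {k H : Type*} [Field k] [Ring H]

/-- The trivial module algebra `k` of a bialgebra `H`. -/
abbrev trivialModule (k H : Type*) [Field k] [Ring H] [Bialgebra k H] : Module H k :=
  Module.compHom k (Bialgebra.counitAlgHom k H).toRingHom

/-- A finite dimensional Hopf algebra has a nonzero left integral. -/
theorem exists_left_integral [HopfAlgebra k H] [Module.Finite k H] :
    ∃ t : H, t ≠ 0 ∧ ∀ h : H, h * t = counit (R := k) h • t := by
  let _ := trivialModule k H
  have smul_def : ∀ (h : H) (x : k), h • x = counit (R := k) h * x := fun _ _ => rfl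
  have : IsScalarTower k H k := ⟨fun c h x => by simp [smul_def, mul_assoc]⟩
  have sum_counit : ∀ h : H, ∑ i ∈ (Repr.arbitrary k h).index,
      counit (R := k) ((Repr.arbitrary k h).left i) * counit (R := k) ((Repr.arbitrary k h).right i)
        = counit (R := k) h := fun h => by
    have := congrArg (counit (R := k)) (sum_counit_smul (Repr.arbitrary k h))
    simpa using this
  have : LeftModuleAlgebra k H k :=
    { smul_one' := fun h => by simp [smul_def]
      smul_mul' := fun h a b => by
        rw [← (Repr.arbitrary k h).eq, smul_def]
        nth_rw 1 [← sum_counit h]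
        simp only [map_sum, Finset.sum_mul]
        refine Finset.sum_congr rfl fun i _ => ?_
        simp [smul_def]
        ring }
  obtain ⟨-, ⟨φ⟩⟩ := SmashProduct.isFrobeniusAlgebra_of_left (H := H) (isFrobeniusAlgebra_self k)
  let p : SmashProduct k k H →ₗ[k] H := (TensorProduct.lid k H).toLinearMap
  have hp : ∀ c g, p (SmashProduct.mk k c g) = c • g := fun c g => TensorProduct.lid_tmul _ _
  have hpl : ∀ h x, p (SmashProduct.inr k k H h * x) = h * p x := fun h x => by
    induction x using SmashProduct.induction_on with
    | zero => simp
    | add x y hx hy => simp only [mul_add, map_add, hx, hy]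
    | mk c g =>
      rw [SmashProduct.inr_mul_mk _ _ _ (Repr.arbitrary k h), map_sum]
      simp only [hp, smul_def]
      have := congrArg (fun x => c • (x * g)) (sum_counit_smul (Repr.arbitrary k h))
      simpa only [Finset.sum_mul, mul_comm _ c, mul_smul, ← Finset.smul_sum, mul_smul_comm,
        smul_mul_assoc] using this
  have hpr : ∀ h x, counit (R := k) (p (x * SmashProduct.inr k k H h)) =
      counit (R := k) h * counit (R := k) (p x) := fun h x => by
    induction x using SmashProduct.induction_on with
    | zero => simp
    | add x y hx hy => simp only [mul_add, add_mul, map_add, hx, hy]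
    | mk c g =>
      rw [SmashProduct.inr_apply, SmashProduct.mk_mul_mk c g 1 h (Repr.arbitrary k g), map_sum,
        map_sum]
      simp only [hp, smul_def, map_smul, Bialgebra.counit_mul, smul_eq_mul, mul_one]
      rw [← sum_counit g, Finset.mul_sum, Finset.mul_sum]
      exact Finset.sum_congr rfl fun i _ => by ring
  -- The counit is a form on which `H` acts through `ε`, so its preimage under the Frobenius
  -- isomorphism is a left integral. It is nonzero because `ε(1) = 1`.
  let u : LeftDual k (SmashProduct k k H) := counit (R := k) (A := H) ∘ₗ p
  have hu : ∀ h, SmashProduct.inr k k H h • u = counit (R := k) h • u := fun h =>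
    DFunLike.ext _ _ fun x => hpr h x
  have ht : ∀ h, SmashProduct.inr k k H h * φ.symm u = counit (R := k) h • φ.symm u := fun h => by
    rw [← smul_eq_mul, ← map_smul, hu]
    exact LinearMap.map_smul_of_tower φ.symm.toLinearMap _ _
  refine ⟨p (φ.symm u), fun h0 => ?_, fun h => by rw [← hpl, ht, map_smul]⟩
  have h1 : φ.symm u = 0 := (TensorProduct.lid k H).map_eq_zero_iff.1 h0
  have h2 : u = 0 := by simpa using h1
  have h3 := DFunLike.congr_fun h2 (SmashProduct.mk k 1 1)
  change counit (R := k) (p _) = 0 at h3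
  simp [hp] at h3

/-- The left coregular action `x ↦ ∑ f(x₁) x₂` of a linear form `f` on a coalgebra. -/
noncomputable def coregularLeft [Algebra k H] [Coalgebra k H] (x : H) :
    (H →ₗ[k] k) →ₗ[k] H where
  toFun f := TensorProduct.lid k H (f.rTensor H (comul x))
  map_add' f g := by simp [LinearMap.rTensor_add]
  map_smul' c f := by simp [LinearMap.rTensor_smul]

end HopfAlgebra

/-! ### Bijectivity of the antipode. -/

namespace HopfAlgebra

open Coalgebra

variable {k H : Type*} [Field k] [Ring H]

theorem coregularLeft_apply [Algebra k H] [Coalgebra k H] (x : H) (f : H →ₗ[k] k) :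
    coregularLeft x f = TensorProduct.lid k H (f.rTensor H (comul x)) := rfl

theorem coregularLeft_repr [Algebra k H] [Coalgebra k H] {κ : Type*} (x : H) (f : H →ₗ[k] k)
    (r : Repr k x κ) : coregularLeft x f = ∑ i ∈ r.index, f (r.left i) • r.right i := by
  simp [coregularLeft_apply, ← r.eq]

theorem coregularLeft_mul [Bialgebra k H] {κ : Type*} (f : H →ₗ[k] k) (x t : H)
    (r : Repr k x κ) : coregularLeft (x * t) f =
      ∑ i ∈ r.index, r.right i * coregularLeft t (f ∘ₗ LinearMap.mulLeft k (r.left i)) := by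
  simp only [coregularLeft_apply, Bialgebra.comul_mul]
  rw [← r.eq, ← (Repr.arbitrary k t).eq, Finset.sum_mul, map_sum, map_sum]
  refine Finset.sum_congr rfl fun i _ => ?_
  simp [Finset.mul_sum]

variable [HopfAlgebra k H]

/-- As `t` is an integral, `∑ f(t₁) S(t₂) h = ∑ f(h₁t₁) S(h₂t₂) h₃ = ∑ f(h t₁) S(t₂)`. Hence the
elements `S(∑ f(t₁) t₂)`, for varying `f`, form a right ideal. -/
theorem antipode_coregularLeft_mul {t : H} (ht : ∀ h : H, h * t = counit (R := k) h • t)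
    (f : H →ₗ[k] k) (h : H) : antipode k (coregularLeft t f) * h =
      antipode k (coregularLeft t (f ∘ₗ LinearMap.mulLeft k h)) := by
  let r := Repr.arbitrary k h
  let K : H →ₗ[k] H := antipode k ∘ₗ coregularLeft t ∘ₗ (LinearMap.mul k H).compr₂ f
  have hK : ∀ x, K x = antipode k (coregularLeft t (f ∘ₗ LinearMap.mulLeft k x)) := fun _ => rfl
  let T : H ⊗[k] (H ⊗[k] H) →ₗ[k] H := LinearMap.mul' k H ∘ₗ
    TensorProduct.map K (LinearMap.mul' k H ∘ₗ (antipode k).rTensor H)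
  have h1 : ∀ x y, counit (R := k) x • (antipode k (coregularLeft t f) * y) =
      T (TensorProduct.assoc k H H H (comul x ⊗ₜ y)) := fun x y => by
    rw [← smul_mul_assoc, ← map_smul, ← (Repr.arbitrary k x).eq]
    have : counit (R := k) x • coregularLeft t f = coregularLeft (x * t) f := by
      rw [ht, coregularLeft_apply, coregularLeft_apply]; simp
    rw [this, coregularLeft_mul f x t (Repr.arbitrary k x), map_sum, Finset.sum_mul,
      TensorProduct.sum_tmul, map_sum, map_sum]
    refine Finset.sum_congr rfl fun i _ => ?_
    simp [T, hK, antipode_mul_antidistrib, mul_assoc]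
  calc antipode k (coregularLeft t f) * h
      = ∑ i ∈ r.index, counit (R := k) (r.left i) •
          (antipode k (coregularLeft t f) * r.right i) := by
        nth_rw 1 [← sum_counit_smul r]
        simp only [Finset.mul_sum, mul_smul_comm]
    _ = T (TensorProduct.assoc k H H H ((comul (R := k) (A := H)).rTensor H (comul h))) := by
        simp only [h1, ← map_sum]
        simp [← r.eq]
    _ = K h := by
        rw [coassoc_apply, ← r.eq]
        have := congrArg (TensorProduct.rid k H) (sum_tmul_counit_eq r)
        simp only [map_sum, TensorProduct.rid_tmul, one_smul] at this
        conv_rhs => rw [← this]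
        simp [T, ← Algebra.commutes, ← Algebra.smul_def]
    _ = _ := hK h

/-- The sum is `S` applied to `∑ f(t₁) S(t₂) t₃ = f(t) 1`. It serves to place `1` in the right ideal
above. -/
theorem sum_antipode_mul_antipode_antipode (f : H →ₗ[k] k) {t : H} {κ : Type*} (r : Repr k t κ) :
    ∑ i ∈ r.index, antipode k (r.right i) * antipode k (antipode k (coregularLeft (r.left i) f)) =
      f t • 1 := by
  let T : H ⊗[k] (H ⊗[k] H) →ₗ[k] H := (TensorProduct.lid k H).toLinearMap ∘ₗ
    TensorProduct.map f (LinearMap.mul' k H ∘ₗ (antipode k).rTensor H)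
  have h1 : ∀ x y, antipode k (coregularLeft x f) * y =
      T (TensorProduct.assoc k H H H (comul x ⊗ₜ y)) := fun x y => by
    rw [coregularLeft_repr x f (Repr.arbitrary k x), ← (Repr.arbitrary k x).eq]
    simp [T, TensorProduct.sum_tmul, Finset.sum_mul]
  have h2 : ∑ i ∈ r.index, antipode k (coregularLeft (r.left i) f) * r.right i = f t • 1 := by
    simp only [h1, ← map_sum]
    have : ∑ i ∈ r.index, comul (R := k) (r.left i) ⊗ₜ[k] r.right i =
        (comul (R := k) (A := H)).rTensor H (comul t) := by simp [← r.eq]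
    rw [this, coassoc_apply, ← r.eq]
    have := congrArg (fun w => f (TensorProduct.rid k H w)) (sum_tmul_counit_eq r)
    simp only [map_sum, TensorProduct.rid_tmul, one_smul, map_smul, smul_eq_mul] at this
    simp [T, ← this, Finset.sum_smul, Algebra.algebraMap_eq_smul_one, mul_smul]
  simp only [← antipode_mul_antidistrib, ← map_sum, h2, map_smul, antipode_one]

/-- The antipode of a finite dimensional Hopf algebra is surjective. -/
theorem antipode_surjective [Module.Finite k H] : Function.Surjective (antipode k (A := H)) := by
  obtain ⟨t, ht0, ht⟩ := exists_left_integral (k := k) (H := H)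
  obtain ⟨f, hf⟩ := Module.Projective.exists_dual_eq_one k ht0
  let e := Module.finBasis k H
  let r := Repr.arbitrary k t
  -- `L x = ∑ f(x₁) x₂`. Expanding `L(t₁)` in the basis `e` rewrites `∑ S(t₂) S²(L(t₁))` as a sum of
  -- elements of the right ideal times `S²(e_j)`.
  let L : H →ₗ[k] H := (TensorProduct.lid k H).toLinearMap ∘ₗ f.rTensor H ∘ₗ comul
  have h1 : ∑ j, antipode k (coregularLeft t (e.coord j ∘ₗ L)) *
      antipode k (antipode k (e j)) = 1 := by
    calc _ = ∑ i ∈ r.index, antipode k (r.right i) *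
          antipode k (antipode k (∑ j, e.coord j (L (r.left i)) • e j)) := by
          simp only [coregularLeft_repr t _ r, map_sum, Finset.sum_mul, Finset.mul_sum, map_smul,
            smul_mul_assoc, mul_smul_comm, LinearMap.comp_apply]
          exact Finset.sum_comm
      _ = f t • 1 := by
          rw [← sum_antipode_mul_antipode_antipode f r]
          simp only [Module.Basis.coord_apply, e.sum_repr]
          rfl
      _ = 1 := by rw [hf, one_smul]
  -- The right ideal contains `1`, hence every `h`, and it lies in the image of `S`.
  intro h
  rw [← one_mul h, ← h1, Finset.sum_mul]
  simp only [antipode_coregularLeft_mul ht, ← map_sum]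
  exact ⟨_, rfl⟩

theorem antipode_bijective [Module.Finite k H] : Function.Bijective (antipode k (A := H)) :=
  ⟨LinearMap.injective_iff_surjective.2 antipode_surjective, antipode_surjective⟩

/-- The inverse of the antipode of a finite dimensional Hopf algebra. -/
noncomputable def antipodeInv (k H : Type*) [Field k] [Ring H] [HopfAlgebra k H]
    [Module.Finite k H] : H →ₗ[k] H :=
  (LinearEquiv.ofBijective (antipode k) antipode_bijective).symm.toLinearMap

theorem antipode_antipodeInv [Module.Finite k H] (h : H) : antipode k (antipodeInv k H h) = h :=
  (LinearEquiv.ofBijective (antipode k (A := H)) antipode_bijective).apply_symm_apply h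

/-- Applying the injective, order-reversing `S` turns this into `∑ h₁ S(h₂) = ε(h) 1`. -/
theorem sum_mul_antipodeInv [Module.Finite k H] {κ : Type*} (h : H) (r : Repr k h κ) :
    ∑ i ∈ r.index, r.right i * antipodeInv k H (r.left i) = counit (R := k) h • 1 := by
  refine antipode_bijective (k := k).1 ?_
  simp only [map_sum, antipode_mul_antidistrib, antipode_antipodeInv, map_smul, antipode_one]
  exact sum_mul_antipode_eq_smul r

end HopfAlgebra

/-! ### From `A # H` to `A`. -/

namespace SmashProduct

open Coalgebra HopfAlgebra

variable {k A H : Type*} [Field k] [Ring A] [Algebra k A] [Ring H] [HopfAlgebra k H]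
  [Module H A] [IsScalarTower k H A] [LeftModuleAlgebra k H A]

/-- The elements `(1 # g) (c # 1)` span the smash product. -/
theorem mk_eq_sum_inr_mul [Module.Finite k H] {κ : Type*} (a : A) (h : H) (r : Repr k h κ) :
    mk k a h = ∑ i ∈ r.index,
      inr k A H (r.right i) * mk k (antipodeInv k H (r.left i) • a) 1 := by
  -- `M(x ⊗ y) = (y S⁻¹(x)) • a`. The right side of the claim expands to `∑ (h₂ S⁻¹(h₁)) • a # h₃`,
  -- which collapses to `a # h`.
  let M : H ⊗[k] H →ₗ[k] A := (LinearMap.toSpanSingleton H A a).restrictScalars k ∘ₗ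
    LinearMap.mul' k H ∘ₗ (TensorProduct.comm k H H).toLinearMap ∘ₗ (antipodeInv k H).rTensor H
  let T : (H ⊗[k] H) ⊗[k] H →ₗ[k] SmashProduct k A H := M.rTensor H
  have hM : ∀ x, M (comul x) = counit (R := k) x • a := fun x => by
    have := congrArg (fun z : H => z • a) (sum_mul_antipodeInv x (Repr.arbitrary k x))
    rw [← (Repr.arbitrary k x).eq]
    simpa [M, Finset.sum_smul] using this
  have hT : ∀ x y, inr k A H y * mk k (antipodeInv k H x • a) 1 =
      T ((TensorProduct.assoc k H H H).symm (x ⊗ₜ comul y)) := fun x y => by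
    rw [inr_mul_mk _ _ _ (Repr.arbitrary k y), ← (Repr.arbitrary k y).eq]
    simp only [TensorProduct.tmul_sum, map_sum, ← mul_smul, mul_one]
    rfl
  have h1 : ∑ i ∈ r.index, r.left i ⊗ₜ[k] comul (R := k) (r.right i) =
      (comul (R := k) (A := H)).lTensor H (comul h) := by simp [← r.eq]
  simp only [hT, ← map_sum]
  rw [h1, coassoc_symm_apply, ← r.eq]
  have h2 : ∀ x y, T (comul x ⊗ₜ y) = mk k (counit (R := k) x • a) y := fun x y => by
    rw [← hM]
    rfl
  simp only [map_sum, LinearMap.rTensor_tmul, h2]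
  change a ⊗ₜ[k] h = ∑ i ∈ r.index, (counit (R := k) (r.left i) • a) ⊗ₜ[k] r.right i
  simp only [TensorProduct.smul_tmul, ← TensorProduct.tmul_sum, sum_counit_smul]

variable (k A H) in
/-- The embedding `a ↦ a # 1` of `A` in `A # H`. -/
noncomputable def inl : A →ₐ[k] SmashProduct k A H :=
  AlgHom.ofLinearMap ((TensorProduct.mk k A H).flip 1) rfl fun a b => (mk_one_mul_mk a b 1).symm

theorem inl_apply (a : A) : inl k A H a = mk k a 1 := rfl

theorem leftDual_eq_zero [Module.Finite k H] (f : LeftDual k (SmashProduct k A H))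
    (hf : ∀ h a, f (inr k A H h * inl k A H a) = 0) : f = 0 := by
  refine DFunLike.ext _ _ fun x => ?_
  induction x using SmashProduct.induction_on with
  | zero => exact LeftDual.map_zero f
  | add x y hx hy => rw [LeftDual.map_add, hx, hy, LeftDual.map_add]
  | mk a h =>
    rw [mk_eq_sum_inr_mul a h (Repr.arbitrary k h)]
    refine (map_sum (show SmashProduct k A H →ₗ[k] k from f) _ _).trans ?_
    exact Finset.sum_eq_zero fun i _ => hf _ _

theorem isFrobeniusAlgebra_left [Module.Finite k A] [Module.Finite k H]
    (hB : IsFrobeniusAlgebra k (SmashProduct k A H)) : IsFrobeniusAlgebra k A := by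
  obtain ⟨-, ⟨φ⟩⟩ := hB
  have : Nontrivial H := (Bialgebra.counitAlgHom k H).toRingHom.domain_nontrivial
  let e := Module.finBasis k H
  have : Nonempty (Fin (Module.finrank k H)) := e.index_nonempty
  -- `θ` identifies `Aⁿ` with `A # H` as left `A`-modules, and `π j` restricts a form along `c ↦ (1
  -- # e_j)(c # 1)`. This map is right `A`-linear, which makes `π j` left `A`-linear.
  let θ (a : Fin (Module.finrank k H) → A) : SmashProduct k A H := ∑ i, mk k (a i) (e i)
  let π (j) (f : LeftDual k (SmashProduct k A H)) : LeftDual k A :=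
    (show SmashProduct k A H →ₗ[k] k from f) ∘ₗ
      LinearMap.mulLeft k (inr k A H (e j)) ∘ₗ (inl k A H).toLinearMap
  have hπ : ∀ j f c, π j f c = f (inr k A H (e j) * inl k A H c) := fun _ _ _ => rfl
  have hθ : ∀ a b, θ (a + b) = θ a + θ b := fun a b => by
    simp only [θ, ← Finset.sum_add_distrib]
    exact Finset.sum_congr rfl fun i _ => TensorProduct.add_tmul _ _ _
  have hθ' : ∀ c a, θ (c • a) = inl k A H c * θ a := fun c a => by
    simp only [θ, Finset.mul_sum, inl_apply, mk_one_mul_mk]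
    rfl
  let Ψ : (Fin (Module.finrank k H) → A) →ₗ[A] (Fin (Module.finrank k H) → LeftDual k A) :=
    { toFun a j := π j (φ (θ a))
      map_add' a b := by
        rw [hθ, map_add]
        rfl
      map_smul' c a := by
        funext j
        refine DFunLike.ext _ _ fun x => ?_
        rw [hθ', ← smul_eq_mul, map_smul, hπ, LeftDual.smul_apply, mul_assoc, ← map_mul]
        rfl }
  refine isFrobeniusAlgebra_of_injective_pi Ψ ((injective_iff_map_eq_zero _).2 fun a ha => ?_)
  have h1 : φ (θ a) = 0 := by
    refine leftDual_eq_zero _ fun h c => ?_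
    -- For fixed `c` the value at `(1 # h)(c # 1)` is linear in `h`, so its vanishing on the basis
    -- `e` suffices.
    let g : H →ₗ[k] k := (show SmashProduct k A H →ₗ[k] k from φ (θ a)) ∘ₗ
      LinearMap.mulRight k (inl k A H c) ∘ₗ (inr k A H).toLinearMap
    have : g = 0 := e.ext fun j => DFunLike.congr_fun (congrFun ha j) c
    exact LinearMap.congr_fun this h
  have h2 : θ a = 0 := by simpa using h1
  funext j
  have h3 := congrArg (evalRight (e.coord j)) h2
  simpa [θ, evalRight_mk, Finsupp.single_apply] using h3

end SmashProduct

theorem mainTheorem10 {k : Type*} [Field k]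
    {H : Type*} [Ring H] [HopfAlgebra k H] [Module.Finite k H]
    {A : Type*} [Ring A] [Algebra k A] [Module.Finite k A]
    [Module H A] [IsScalarTower k H A] [LeftModuleAlgebra k H A] :
    IsFrobeniusAlgebra k (SmashProduct k A H) ↔ IsFrobeniusAlgebra k A :=
  ⟨SmashProduct.isFrobeniusAlgebra_left, SmashProduct.isFrobeniusAlgebra_of_left⟩
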